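/- Let $X_1,X_2$ be complex Banach spaces, with duals $X_1',X_2'$, and let $L(X)$ denote the algebra of bounded operators on $X$. Let $X_1\tilde\otimes X_2$ be a tensor product of $X_1$ and $X_2$ relative to $\langle X_1,X_1'\rangle$ and $\langle X_2,X_2'\rangle$ in the sense of Eschmeier, that is, a Banach space $X_1\tilde\otimes X_2$ with continuous bilinear maps $X_1\times X_2\to X_1\tilde\otimes X_2$, $(x,y)\mapsto x\otimes y$, and $L(X_1)\times L(X_2)\to L(X_1\tilde\otimes X_2)$, $(A,B)\mapsto A\otimes B$, such that (T1) $\|x\otimes y\|=\|x\|\,\|y\|$; (T2) $(A\otimes B)(x\otimes y)=Ax\otimes By$; (T3) $(A_1\otimes B_1)(A_2\otimes B_2)=A_1A_2\otimes B_1B_2$ and $I\otimes I=I$; (T4) $\operatorname{Im}(f_{x,u}\otimes I)\subseteq\{x\otimes y : y\in X_2\}$ and $\operatorname{Im}(I\otimes f_{y,v})\subseteq\{x\otimes y : x\in X_1\}$ for all $x\in X_1$, $u\in X_1'$, $y\in X_2$, $v\in X_2'$, where $f_{x,u}(x')=u(x')\,x$ and $f_{y,v}(y')=v(y')\,y$.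 For a commuting tuple $T=(T_1,\dots,T_n)$ of bounded operators on a Banach space $X$, put $\hat T:X^n\to X$, $\hat T(x_1,\dots,x_n)=\sum_i T_ix_i$, and $\tilde T:X\to X^n$, $\tilde T(x)=(T_1x,\dots,T_nx)$; for $\lambda\in\mathbb C^n$ let $T-\lambda=(T_1-\lambda_1I,\dots,T_n-\lambda_nI)$. Write $R$ and $N$ for range and kernel. Define the following subsets of $\mathbb C^n$: * $\sigma_\delta(T)=\{\lambda : R(T_1-\lambda_1)+\dots+R(T_n-\lambda_n)\neq X\}$; * $sp_\delta(T)=\sigma_\delta(T)\cup\{\lambda : N(\widehat{T-\lambda})\text{ has no direct (closed) complement in }X^n\}$; * $\sigma_\pi(T)=\{\lambda : N(\widetilde{T-\lambda})\ne 0\text{ or }R(\widetilde{T-\lambda})\text{ is not closed}\}$; * $sp_\pi(T)=\sigma_\pi(T)\cup\{\lambda : R(\widetilde{T-\lambda})\text{ has no direct (closed) complement in }X^n\}$. Let $S=(S_1,\dots,S_n)$ and $T=(T_1,\dots,T_m)$ be tuples of commuting bounded operators on $X_1$ and $X_2$ respectively, and let $(S\otimes I,I\otimes T)=(S_1\otimes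 I,\dots,S_n\otimes I,I\otimes T_1,\dots,I\otimes T_m)$ on $X_1\tilde\otimes X_2$. Then, identifying $\mathbb C^n\times\mathbb C^m$ with $\mathbb C^{n+m}$, (i) $\sigma_\delta(S)\times\sigma_\delta(T)\subseteq\sigma_\delta(S\otimes I,I\otimes T)\subseteq sp_\delta(S\otimes I,I\otimes T)\subseteq sp_\delta(S)\times sp_\delta(T)$; (ii) $\sigma_\pi(S)\times\sigma_\pi(T)\subseteq\sigma_\pi(S\otimes I,I\otimes T)\subseteq sp_\pi(S\otimes I,I\otimes T)\subseteq sp_\pi(S)\times sp_\pi(T)$. In addition, if $X_1$ and $X_2$ are Hilbert spaces, all the inclusions in (i) and (ii) are equalities. -/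

import Mathlib

/-- A tensor product of the Banach spaces `X` and `Y` relative to the dual pairings `⟨X, X'⟩` and
`⟨Y, Y'⟩`, carried by the Banach space `Z`. For these pairings every bounded operator on `X`
(resp. `Y`) has an adjoint on the dual, so the operator algebras are all of `L(X)` and `L(Y)`.
Continuous bilinear maps are written in curried form. The rank one operator
`x' ↦ ⟨x', u⟩ x` is `u.smulRight x`. -/
structure BanachTensorProduct (X Y Z : Type*)
    [NormedAddCommGroup X] [NormedSpace ℂ X] [CompleteSpace X]
    [NormedAddCommGroup Y] [NormedSpace ℂ Y] [CompleteSpace Y]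
    [NormedAddCommGroup Z] [NormedSpace ℂ Z] [CompleteSpace Z] where
  /-- `(x, y) ↦ x ⊗ y` -/
  tmul : X →L[ℂ] Y →L[ℂ] Z
  /-- `(A, B) ↦ A ⊗ B` on operators -/
  map : (X →L[ℂ] X) →L[ℂ] (Y →L[ℂ] Y) →L[ℂ] (Z →L[ℂ] Z)
  norm_tmul : ∀ x y, ‖tmul x y‖ = ‖x‖ * ‖y‖
  map_tmul : ∀ A B x y, map A B (tmul x y) = tmul (A x) (B y)
  map_comp_map : ∀ A₁ B₁ A₂ B₂, (map A₁ B₁).comp (map A₂ B₂) = map (A₁.comp A₂) (B₁.comp B₂)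
  map_id_id : map (ContinuousLinearMap.id ℂ X) (ContinuousLinearMap.id ℂ Y) =
    ContinuousLinearMap.id ℂ Z
  range_map_rankOne_id : ∀ (x : X) (u : X →L[ℂ] ℂ),
    Set.range (map (u.smulRight x) (ContinuousLinearMap.id ℂ Y)) ⊆ Set.range fun y => tmul x y
  range_map_id_rankOne : ∀ (y : Y) (v : Y →L[ℂ] ℂ),
    Set.range (map (ContinuousLinearMap.id ℂ X) (v.smulRight y)) ⊆ Set.range fun x => tmul x y

/-- The complete complex normed space `X` is a Hilbert space: its norm is induced by an inner
product (compatible with the given vector space structure). -/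
def IsHilbertSpace (X : Type*) [NormedAddCommGroup X] [inst : NormedSpace ℂ X]
    [CompleteSpace X] : Prop :=
  ∃ I : InnerProductSpace ℂ X, I.toNormedSpace = inst

namespace OperatorTuple

variable {X : Type*} [NormedAddCommGroup X] [NormedSpace ℂ X] {n : ℕ}

/-- The tuple `T - l = (T₁ - l₁ I, …, Tₙ - lₙ I)`. -/
def shift (T : Fin n → X →L[ℂ] X) (l : Fin n → ℂ) : Fin n → X →L[ℂ] X :=
  fun i => T i - l i • ContinuousLinearMap.id ℂ X

/-- The operator `X ^ n → X`, `(x₁, …, xₙ) ↦ T₁ x₁ + … + Tₙ xₙ`. -/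
def row (T : Fin n → X →L[ℂ] X) : (Fin n → X) →L[ℂ] X :=
  ∑ i, (T i).comp (ContinuousLinearMap.proj i)

/-- The operator `X → X ^ n`, `x ↦ (T₁ x, …, Tₙ x)`. -/
def col (T : Fin n → X →L[ℂ] X) : X →L[ℂ] (Fin n → X) :=
  ContinuousLinearMap.pi T

/-- The subspace `R(T₁) + … + R(Tₙ)` of `X`. -/
def rangeSum (T : Fin n → X →L[ℂ] X) : Submodule ℂ X :=
  ⨆ i, (T i).range

/-- The defect spectrum: `R(T₁ - l₁) + … + R(Tₙ - lₙ)` has nonzero codimension, that is, it is a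
proper subspace. -/
def defectSpectrum (T : Fin n → X →L[ℂ] X) : Set (Fin n → ℂ) :=
  {l | rangeSum (shift T l) ≠ ⊤}

/-- The approximate point spectrum. -/
def approxPointSpectrum (T : Fin n → X →L[ℂ] X) : Set (Fin n → ℂ) :=
  {l | (col (shift T l)).ker ≠ ⊥ ∨ ¬ IsClosed ((col (shift T l)).range : Set (Fin n → X))}

/-- The split defect spectrum: the defect spectrum together with the points at which the kernel of
the row operator has no (topological) direct complement in `X ^ n`. -/
def splitDefectSpectrum (T : Fin n → X →L[ℂ] X) : Set (Fin n → ℂ) :=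
  defectSpectrum T ∪ {l | ¬ (row (shift T l)).ker.ClosedComplemented}

/-- The split approximate point spectrum: the approximate point spectrum together with the points
at which the range of the column operator has no (topological) direct complement in `X ^ n`. -/
def splitApproxPointSpectrum (T : Fin n → X →L[ℂ] X) : Set (Fin n → ℂ) :=
  approxPointSpectrum T ∪ {l | ¬ (col (shift T l)).range.ClosedComplemented}

/-- The product of `A ⊆ ℂ ^ n` and `B ⊆ ℂ ^ m` as a subset of `ℂ ^ (n + m)`. -/
def prodSet {n m : ℕ} (A : Set (Fin n → ℂ)) (B : Set (Fin m → ℂ)) : Set (Fin (n + m) → ℂ) :=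
  {p | ∃ l ∈ A, ∃ k ∈ B, p = Fin.append l k}

end OperatorTuple

/-- The tuple `(S ⊗ I, I ⊗ T) = (S₁ ⊗ I, …, Sₙ ⊗ I, I ⊗ T₁, …, I ⊗ Tₘ)` on the tensor product. -/
noncomputable def BanachTensorProduct.tuple {X Y Z : Type*}
    [NormedAddCommGroup X] [NormedSpace ℂ X] [CompleteSpace X]
    [NormedAddCommGroup Y] [NormedSpace ℂ Y] [CompleteSpace Y]
    [NormedAddCommGroup Z] [NormedSpace ℂ Z] [CompleteSpace Z]
    (P : BanachTensorProduct X Y Z) {n m : ℕ}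
    (S : Fin n → X →L[ℂ] X) (T : Fin m → Y →L[ℂ] Y) : Fin (n + m) → Z →L[ℂ] Z :=
  Fin.append (fun i => P.map (S i) (ContinuousLinearMap.id ℂ Y))
    (fun j => P.map (ContinuousLinearMap.id ℂ X) (T j))

/-! Everything is read off two operators. Failure of surjectivity of the row operator is σ_δ, and
absence of a bounded right inverse is sp_δ; failure of the column operator to be bounded below is
σ_π, and absence of a bounded left inverse is sp_π.

One-sided inverses survive tensoring with the identity: ∑ Sᵢ Rᵢ = I gives ∑ (Sᵢ ⊗ I)(Rᵢ ⊗ I) = I. So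
an inverse for either factor yields one for the tensor tuple, and the contrapositives are the upper
inclusions.

The lower inclusions use elementary tensors. For σ_π, approximate eigenvectors x, y give x ⊗ y. For
σ_δ (`not_surjective_row_tuple`), Hahn–Banach gives unit functionals u, v almost annihilating the
ranges of the rows; f_{x,u} ⊗ f_{y,v} then almost kills the bounded combinations that a surjective
tensor row would need to reach x ⊗ y, but not x ⊗ y itself.

Over Hilbert spaces closed subspaces are complemented, so sp and σ agree for each factor and the
chains collapse. -/

open Function

/-! ### Bounded below and surjective operators, and one-sided inverses. -/

namespace ContinuousLinearMap

section RCLike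

variable {𝕜 E F : Type*} [RCLike 𝕜] [NormedAddCommGroup E] [NormedSpace 𝕜 E] [CompleteSpace E]
  [NormedAddCommGroup F] [NormedSpace 𝕜 F]

/-- A bounded operator between Banach spaces is injective with closed range if and only if it is
bounded below. -/
theorem ker_eq_bot_and_isClosed_range_iff [CompleteSpace F] (f : E →L[𝕜] F) :
    (f.ker = ⊥ ∧ IsClosed (f.range : Set F)) ↔ ∃ c > 0, ∀ x, c * ‖x‖ ≤ ‖f x‖ := by
  constructor
  · rintro ⟨h, h'⟩
    obtain ⟨K, hK⟩ := f.antilipschitz_of_injective_of_isClosed_range (LinearMap.ker_eq_bot.1 h)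
      h'
    refine ⟨((K : ℝ) + 1)⁻¹, by positivity, fun x => ?_⟩
    rw [inv_mul_le_iff₀ (by positivity)]
    have := f.bound_of_antilipschitz hK x
    nlinarith [norm_nonneg (f x)]
  · rintro ⟨c, hc, h⟩
    have hK : AntilipschitzWith (Real.toNNReal c⁻¹) f := f.antilipschitz_of_bound fun x => by
      rw [Real.coe_toNNReal _ (by positivity), ← div_eq_inv_mul, le_div_iff₀ hc, mul_comm]
      exact h x
    exact ⟨LinearMap.ker_eq_bot.2 hK.injective, hK.isClosed_range f.uniformContinuous⟩

/-- If every `y` is approximated up to `‖y‖ / 2` by the image of a vector of norm at most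
`C * ‖y‖`, then the operator is surjective. -/
theorem surjective_of_approx_preimage (f : E →L[𝕜] F) {C : ℝ} (hC : 0 ≤ C)
    (H : ∀ y, ∃ x, ‖y - f x‖ ≤ 1 / 2 * ‖y‖ ∧ ‖x‖ ≤ C * ‖y‖) : Surjective f := by
  choose g hg hgC using H
  intro y
  -- Iteration as in the open mapping theorem: the residuals `h^[n] y` at least halve at each step,
  -- so the approximate preimages sum to an exact one.
  let h : F → F := fun y => y - f (g y)
  have hn : ∀ n : ℕ, ‖h^[n] y‖ ≤ (1 / 2) ^ n * ‖y‖ := by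
    intro n
    induction n with
    | zero => simp
    | succ n IH =>
      rw [iterate_succ_apply', pow_succ', mul_assoc]
      exact (hg _).trans (by gcongr)
  have hu : Summable fun n => g (h^[n] y) := by
    refine .of_norm_bounded (g := fun n : ℕ => (1 / 2) ^ n * (C * ‖y‖))
      (summable_geometric_two.mul_right _) fun n => (hgC _).trans ?_
    calc C * ‖h^[n] y‖ ≤ C * ((1 / 2) ^ n * ‖y‖) := by gcongr; exact hn n
      _ = (1 / 2) ^ n * (C * ‖y‖) := by ring
  have hs : ∀ n : ℕ, f (∑ i ∈ Finset.range n, g (h^[i] y)) = y - h^[n] y := by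
    intro n
    induction n with
    | zero => simp
    | succ n IH => rw [Finset.sum_range_succ, map_add, IH, iterate_succ_apply', sub_add]
  have h₁ := (f.continuous.tendsto _).comp hu.hasSum.tendsto_sum_nat
  simp only [comp_def, hs] at h₁
  have h₀ : Filter.Tendsto (fun n => h^[n] y) Filter.atTop (nhds 0) := by
    refine squeeze_zero_norm hn ?_
    simpa using (tendsto_pow_atTop_nhds_zero_of_lt_one (r := (1 / 2 : ℝ)) (by norm_num)
      (by norm_num)).mul_const ‖y‖
  exact ⟨_, tendsto_nhds_unique h₁ (by simpa using tendsto_const_nhds.sub h₀)⟩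

/-- A bounded operator whose transpose is bounded below is surjective. -/
theorem surjective_of_le_norm_comp (f : E →L[𝕜] F) {c : ℝ} (hc : 0 < c)
    (H : ∀ u : F →L[𝕜] 𝕜, c * ‖u‖ ≤ ‖u.comp f‖) : Surjective f := by
  let _ : NormedSpace ℝ F := NormedSpace.restrictScalars ℝ 𝕜 F
  let _ : NormedSpace ℝ E := NormedSpace.restrictScalars ℝ 𝕜 E
  have : IsScalarTower ℝ 𝕜 F := RestrictScalars.isScalarTower ℝ 𝕜 F
  have : IsScalarTower ℝ 𝕜 E := RestrictScalars.isScalarTower ℝ 𝕜 E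
  refine f.surjective_of_approx_preimage (C := c⁻¹) (by positivity) fun y => ?_
  rcases eq_or_ne y 0 with rfl | hy
  · exact ⟨0, by simp⟩
  have hy' : 0 < ‖y‖ := norm_pos_iff.2 hy
  -- With this radius, a functional separating `y` from the closed image of the ball would satisfy
  -- ‖u ∘ f‖ < c‖u‖, against `H`.
  set r := c⁻¹ * ‖y‖ with hr
  have hr0 : 0 < r := by positivity
  have hconv : Convex ℝ (closure (f '' Metric.closedBall 0 r)) :=
    ((convex_closedBall (0 : E) r).linear_image (f.restrictScalars ℝ).toLinearMap).closure
  have hmem : y ∈ closure (f '' Metric.closedBall 0 r) := by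
    by_contra hmem
    obtain ⟨u, s, hs, hsy⟩ := RCLike.geometric_hahn_banach_closed_point (𝕜 := 𝕜) hconv
      isClosed_closure hmem
    have hbd : ∀ x ∈ Metric.closedBall (0 : E) r, ‖u.comp f x‖ ≤ s := by
      intro x hx
      -- Rotating `x` by a unimodular scalar turns the bound on real parts into a bound on moduli.
      obtain ⟨b, hb, hbx⟩ := RCLike.exists_norm_eq_mul_self (u.comp f x)
      have := hs (f (b • x)) (subset_closure ⟨b • x, by simpa [norm_smul, hb] using hx, rfl⟩)
      rw [map_smul, map_smul, smul_eq_mul] at this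
      rw [comp_apply] at hbx
      rw [← hbx, RCLike.ofReal_re] at this
      exact this.le
    have h₁ : ‖u.comp f‖ ≤ s / r := opNorm_bound_of_ball_bound hr0 s _ hbd
    have h₂ : s < ‖u‖ * ‖y‖ := hsy.trans_le ((RCLike.re_le_norm _).trans (u.le_opNorm y))
    have h₃ := (H u).trans h₁
    rw [le_div_iff₀ hr0, hr] at h₃
    have : c * ‖u‖ * (c⁻¹ * ‖y‖) = ‖u‖ * ‖y‖ := by field_simp
    linarith
  obtain ⟨_, ⟨x, hx, rfl⟩, hxy⟩ := Metric.mem_closure_iff.1 hmem (1 / 2 * ‖y‖) (by positivity)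
  exact ⟨x, by rw [← dist_eq_norm]; exact hxy.le, by simpa using hx⟩

/-- The transpose of a non-surjective operator has approximate null vectors of norm one. -/
theorem exists_norm_eq_one_norm_comp_le (f : E →L[𝕜] F) (hf : ¬ Surjective f) {ε : ℝ}
    (hε : 0 < ε) : ∃ u : F →L[𝕜] 𝕜, ‖u‖ = 1 ∧ ‖u.comp f‖ ≤ ε := by
  by_contra! H
  refine hf (f.surjective_of_le_norm_comp hε fun u => ?_)
  rcases eq_or_ne u 0 with rfl | hu
  · simp
  have hu' : 0 < ‖u‖ := norm_pos_iff.2 hu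
  have := (H (((‖u‖⁻¹ : ℝ) : 𝕜) • u) (by simp [norm_smul, hu'.ne'])).le
  rw [smul_comp, norm_smul, RCLike.norm_ofReal, abs_of_pos (by positivity), ← div_eq_inv_mul,
    le_div_iff₀ hu'] at this
  exact this

end RCLike

section Split

variable {𝕜 E F : Type*} [NontriviallyNormedField 𝕜]
  [NormedAddCommGroup E] [NormedSpace 𝕜 E] [CompleteSpace E]
  [NormedAddCommGroup F] [NormedSpace 𝕜 F] [CompleteSpace F]

/-- Given a bounded projection p onto the kernel of a surjective f, the map x ↦ (f x, p x) is an
isomorphism onto F × ker f, and its inverse restricted to F × 0 is a right inverse. Conversely, a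
right inverse g gives the projection I - g f. -/
theorem hasRightInverse_iff (f : E →L[𝕜] F) :
    f.HasRightInverse ↔ Surjective f ∧ f.ker.ClosedComplemented := by
  constructor
  · intro h
    exact ⟨h.surjective,
      f.closedComplemented_ker_of_rightInverse h.rightInverse h.rightInverse_rightInverse⟩
  · rintro ⟨h, p, hp⟩
    have hp' : p.range = ⊤ := LinearMap.range_eq_top.2 fun y => ⟨y, hp y⟩
    let e := f.equivProdOfSurjectiveOfIsCompl p (LinearMap.range_eq_top.2 h) hp'
      (LinearMap.isCompl_of_proj hp)
    refine ⟨(e.symm : F × f.ker →L[𝕜] E).comp (inl 𝕜 F f.ker), fun y => ?_⟩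
    have : e (e.symm (y, 0)) = (y, 0) := e.apply_symm_apply _
    exact congrArg Prod.fst this

theorem hasLeftInverse_iff (f : E →L[𝕜] F) :
    f.HasLeftInverse ↔
      (f.ker = ⊥ ∧ IsClosed (f.range : Set F)) ∧ f.range.ClosedComplemented := by
  constructor
  · intro h
    exact ⟨⟨LinearMap.ker_eq_bot.2 h.injective, h.isClosed_range⟩,
      h.closedComplemented_range⟩
  · rintro ⟨⟨h₁, h₂⟩, h₃⟩
    exact .of_injective_of_isClosed_range_of_closedComplement_range (LinearMap.ker_eq_bot.1 h₁)
      h₂ h₃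

end Split

end ContinuousLinearMap

/-- Every closed subspace of a finite power of a Hilbert space is complemented. -/
theorem IsHilbertSpace.closedComplemented {X : Type*} [NormedAddCommGroup X] [NormedSpace ℂ X]
    [CompleteSpace X] (hX : IsHilbertSpace X) {n : ℕ} (p : Submodule ℂ (Fin n → X))
    (hp : IsClosed (p : Set (Fin n → X))) : p.ClosedComplemented := by
  obtain ⟨I, rfl⟩ := hX
  -- The sup norm on the power need not be Hilbertian; the equivalent ℓ² norm is, and there the
  -- orthogonal projection is available.
  let e := PiLp.continuousLinearEquiv 2 ℂ (fun _ : Fin n => X)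
  let q : Submodule ℂ (PiLp 2 fun _ : Fin n => X) := p.comap e.toLinearEquiv.toLinearMap
  have hq : IsClosed (q : Set (PiLp 2 fun _ : Fin n => X)) := hp.preimage e.continuous
  have : CompleteSpace q := hq.completeSpace_coe
  let π := q.orthogonalProjectionOnto
  refine ⟨((e : (PiLp 2 fun _ : Fin n => X) →L[ℂ] (Fin n → X)).comp
    (q.subtypeL.comp (π.comp (e.symm : (Fin n → X) →L[ℂ] (PiLp 2 fun _ : Fin n => X))))).codRestrict
      p fun y => (π (e.symm y)).2, fun x => ?_⟩
  have hx : e.symm x ∈ q := by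
    change e (e.symm x) ∈ p
    simp
  ext1
  change e (π (e.symm x)) = x
  rw [Submodule.orthogonalProjectionOnto_mem_subspace_eq_self (⟨e.symm x, hx⟩ : q)]
  simp

/-! ### Spectra of a single tuple. -/

namespace OperatorTuple

section

variable {X : Type*} [NormedAddCommGroup X] [NormedSpace ℂ X] {n : ℕ}

theorem row_apply (T : Fin n → X →L[ℂ] X) (a : Fin n → X) : row T a = ∑ i, T i (a i) := by
  simp [row]

theorem row_single (T : Fin n → X →L[ℂ] X) (i : Fin n) (x : X) :
    row T (Pi.single i x) = T i x := by
  rw [row_apply, Finset.sum_eq_single i] <;> simp +contextual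

theorem rangeSum_eq_top_iff (T : Fin n → X →L[ℂ] X) : rangeSum T = ⊤ ↔ Surjective (row T) := by
  have : rangeSum T = (row T).range := by
    apply le_antisymm
    · refine iSup_le fun i => ?_
      rintro _ ⟨x, rfl⟩
      exact ⟨Pi.single i x, row_single T i x⟩
    · rintro _ ⟨a, rfl⟩
      change row T a ∈ _
      rw [row_apply]
      exact Submodule.sum_mem _ fun i _ => Submodule.mem_iSup_of_mem i ⟨a i, rfl⟩
  rw [this]
  exact LinearMap.range_eq_top

theorem col_apply (T : Fin n → X →L[ℂ] X) (x : X) (i : Fin n) : col T x i = T i x := rfl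

variable [CompleteSpace X]

/-- One-sided invertibility is the form of the condition that passes to tensor products. -/
theorem mem_splitDefectSpectrum {T : Fin n → X →L[ℂ] X} {l : Fin n → ℂ} :
    l ∈ splitDefectSpectrum T ↔ ¬ (row (shift T l)).HasRightInverse := by
  rw [ContinuousLinearMap.hasRightInverse_iff, ← rangeSum_eq_top_iff, splitDefectSpectrum,
    Set.mem_union, not_and_or]
  rfl

theorem mem_splitApproxPointSpectrum {T : Fin n → X →L[ℂ] X} {l : Fin n → ℂ} :
    l ∈ splitApproxPointSpectrum T ↔ ¬ (col (shift T l)).HasLeftInverse := by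
  rw [ContinuousLinearMap.hasLeftInverse_iff, splitApproxPointSpectrum,
    Set.mem_union, not_and_or, not_and_or]
  rfl

/-- Approximate point spectrum in terms of joint approximate eigenvectors. -/
theorem mem_approxPointSpectrum {T : Fin n → X →L[ℂ] X} {l : Fin n → ℂ} :
    l ∈ approxPointSpectrum T ↔ ∀ ε > 0, ∃ x, ‖x‖ = 1 ∧ ∀ i, ‖shift T l i x‖ ≤ ε := by
  have : l ∈ approxPointSpectrum T ↔ ¬ ((col (shift T l)).ker = ⊥ ∧
      IsClosed ((col (shift T l)).range : Set (Fin n → X))) := by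
    rw [not_and_or]
    rfl
  rw [this, ContinuousLinearMap.ker_eq_bot_and_isClosed_range_iff]
  constructor
  · intro h ε hε
    by_contra! H
    refine h ⟨ε, hε, fun x => ?_⟩
    rcases eq_or_ne x 0 with rfl | hx
    · simp
    have hx' : 0 < ‖x‖ := norm_pos_iff.2 hx
    obtain ⟨i, hi⟩ := H (((‖x‖⁻¹ : ℝ) : ℂ) • x) (by simp [norm_smul, hx'.ne'])
    rw [map_smul, norm_smul, Complex.norm_real, Real.norm_of_nonneg (by positivity),
      ← div_eq_inv_mul, lt_div_iff₀ hx'] at hi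
    exact hi.le.trans (norm_le_pi_norm (col (shift T l) x) i)
  · rintro h ⟨c, hc, H⟩
    obtain ⟨x, hx, hT⟩ := h (c / 2) (by positivity)
    have h₁ : ‖col (shift T l) x‖ ≤ c / 2 := (pi_norm_le_iff_of_nonneg (by positivity)).2 hT
    have h₂ := H x
    rw [hx] at h₂
    linarith

theorem splitDefectSpectrum_eq_of_isHilbertSpace (hX : IsHilbertSpace X) (T : Fin n → X →L[ℂ] X) :
    splitDefectSpectrum T = defectSpectrum T :=
  Set.union_eq_left.2 fun _ h =>
    (h (hX.closedComplemented _ (ContinuousLinearMap.isClosed_ker _))).elim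

/-- A range without complement cannot be closed, so the point is already in the approximate point
spectrum. -/
theorem splitApproxPointSpectrum_eq_of_isHilbertSpace (hX : IsHilbertSpace X)
    (T : Fin n → X →L[ℂ] X) : splitApproxPointSpectrum T = approxPointSpectrum T :=
  Set.union_eq_left.2 fun _ h => Or.inr fun hc => h (hX.closedComplemented _ hc)

end

theorem mem_prodSet_append {n m : ℕ} {A : Set (Fin n → ℂ)} {B : Set (Fin m → ℂ)}
    {l : Fin n → ℂ} {k : Fin m → ℂ} (hl : l ∈ A) (hk : k ∈ B) : Fin.append l k ∈ prodSet A B :=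
  ⟨l, hl, k, hk, rfl⟩

/-- A subset of `ℂ ^ (n + m)` lies in a product as soon as its points have components in the
factors. -/
theorem subset_prodSet {n m : ℕ} {A : Set (Fin n → ℂ)} {B : Set (Fin m → ℂ)}
    {D : Set (Fin (n + m) → ℂ)} (h : ∀ l k, Fin.append l k ∈ D → l ∈ A ∧ k ∈ B) :
    D ⊆ prodSet A B := by
  intro p hp
  have e : Fin.append (fun i => p (Fin.castAdd m i)) (fun j => p (Fin.natAdd n j)) = p :=
    Fin.append_castAdd_natAdd
  rw [← e] at hp ⊢
  exact mem_prodSet_append (h _ _ hp).1 (h _ _ hp).2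

end OperatorTuple

/-! ### The tensor tuple. -/

namespace BanachTensorProduct

open OperatorTuple

variable {X Y Z : Type*} [NormedAddCommGroup X] [NormedSpace ℂ X] [CompleteSpace X]
  [NormedAddCommGroup Y] [NormedSpace ℂ Y] [CompleteSpace Y]
  [NormedAddCommGroup Z] [NormedSpace ℂ Z] [CompleteSpace Z]
  (P : BanachTensorProduct X Y Z) {n m : ℕ} (S : Fin n → X →L[ℂ] X) (T : Fin m → Y →L[ℂ] Y)

theorem tuple_castAdd (i : Fin n) :
    P.tuple S T (Fin.castAdd m i) = P.map (S i) (ContinuousLinearMap.id ℂ Y) :=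
  Fin.append_left _ _ i

theorem tuple_natAdd (j : Fin m) :
    P.tuple S T (Fin.natAdd n j) = P.map (ContinuousLinearMap.id ℂ X) (T j) :=
  Fin.append_right _ _ j

/-- Since I ⊗ I = I, this reduces every spectral question to the point zero. -/
theorem shift_tuple (l : Fin n → ℂ) (k : Fin m → ℂ) :
    shift (P.tuple S T) (Fin.append l k) = P.tuple (shift S l) (shift T k) := by
  funext i
  refine Fin.addCases (fun i => ?_) (fun j => ?_) i
  · simp [shift, tuple_castAdd, P.map_id_id]
  · simp [shift, tuple_natAdd, P.map_id_id]

theorem map_map_apply (A₁ A₂ : X →L[ℂ] X) (B₁ B₂ : Y →L[ℂ] Y) (z : Z) :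
    P.map A₁ B₁ (P.map A₂ B₂ z) = P.map (A₁.comp A₂) (B₁.comp B₂) z := by
  rw [← P.map_comp_map]
  rfl

theorem exists_norm_map_le :
    ∃ M : ℝ, 0 ≤ M ∧ ∀ (A : X →L[ℂ] X) (B : Y →L[ℂ] Y), ‖P.map A B‖ ≤ M * ‖A‖ * ‖B‖ :=
  ⟨_, by positivity, P.map.le_opNorm₂⟩

theorem row_tuple_apply (a : Fin (n + m) → Z) :
    row (P.tuple S T) a = ∑ i, P.map (S i) (ContinuousLinearMap.id ℂ Y) (a (Fin.castAdd m i)) +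
      ∑ j, P.map (ContinuousLinearMap.id ℂ X) (T j) (a (Fin.natAdd n j)) := by
  simp only [row_apply, Fin.sum_univ_add, tuple_castAdd, tuple_natAdd]

theorem sum_map_left (A : Fin n → X →L[ℂ] X) (z : Z)
    (hA : ∑ i, A i = ContinuousLinearMap.id ℂ X) :
    ∑ i, P.map (A i) (ContinuousLinearMap.id ℂ Y) z = z := by
  have : ∑ i, P.map (A i) (ContinuousLinearMap.id ℂ Y) = ContinuousLinearMap.id ℂ Z := by
    rw [← P.map_id_id, ← hA, map_sum, _root_.sum_apply]
  simpa using DFunLike.congr_fun this z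

theorem sum_map_right (B : Fin m → Y →L[ℂ] Y) (z : Z)
    (hB : ∑ j, B j = ContinuousLinearMap.id ℂ Y) :
    ∑ j, P.map (ContinuousLinearMap.id ℂ X) (B j) z = z := by
  have : ∑ j, P.map (ContinuousLinearMap.id ℂ X) (B j) = ContinuousLinearMap.id ℂ Z := by
    rw [← P.map_id_id, ← hB, map_sum]
  simpa using DFunLike.congr_fun this z

/-- If Rᵢ are the components of a right inverse, the operators Rᵢ ⊗ I in the first n slots and zero
in the others invert the tensor row. -/
theorem hasRightInverse_row_tuple_of_left (h : (row S).HasRightInverse) :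
    (row (P.tuple S T)).HasRightInverse := by
  obtain ⟨R, hR⟩ := h
  refine ⟨ContinuousLinearMap.pi (Fin.append
    (fun i => P.map ((ContinuousLinearMap.proj i).comp R) (ContinuousLinearMap.id ℂ Y)) 0),
    fun z => ?_⟩
  simp only [row_tuple_apply, ContinuousLinearMap.coe_pi', Fin.append_left, Fin.append_right,
    map_map_apply, Pi.zero_apply, _root_.zero_apply, map_zero,
    Finset.sum_const_zero, add_zero]
  refine P.sum_map_left _ z (ContinuousLinearMap.ext fun x => ?_)
  simpa [row_apply] using hR x

theorem hasRightInverse_row_tuple_of_right (h : (row T).HasRightInverse) :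
    (row (P.tuple S T)).HasRightInverse := by
  obtain ⟨R, hR⟩ := h
  refine ⟨ContinuousLinearMap.pi (Fin.append 0
    (fun j => P.map (ContinuousLinearMap.id ℂ X) ((ContinuousLinearMap.proj j).comp R))),
    fun z => ?_⟩
  simp only [row_tuple_apply, ContinuousLinearMap.coe_pi', Fin.append_left, Fin.append_right,
    map_map_apply, Pi.zero_apply, _root_.zero_apply, map_zero,
    Finset.sum_const_zero, zero_add]
  refine P.sum_map_right _ z (ContinuousLinearMap.ext fun x => ?_)
  simpa [row_apply] using hR x

theorem hasLeftInverse_col_tuple_of_left (h : (col S).HasLeftInverse) :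
    (col (P.tuple S T)).HasLeftInverse := by
  obtain ⟨R, hR⟩ := h
  -- The left inverse decomposes over the coordinates of X ^ n, so that ∑ Aᵢ Sᵢ = I.
  let A : Fin n → X →L[ℂ] X := fun i => R.comp (ContinuousLinearMap.single ℂ (fun _ => X) i)
  refine ⟨∑ i, (P.map (A i) (ContinuousLinearMap.id ℂ Y)).comp
    (ContinuousLinearMap.proj (Fin.castAdd m i)), fun z => ?_⟩
  simp only [_root_.sum_apply, ContinuousLinearMap.comp_apply,
    ContinuousLinearMap.proj_apply, col_apply, tuple_castAdd, map_map_apply]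
  refine P.sum_map_left _ z (ContinuousLinearMap.ext fun x => ?_)
  simp only [_root_.sum_apply, ContinuousLinearMap.comp_apply, A,
    ContinuousLinearMap.single_apply, ContinuousLinearMap.id_apply, ← map_sum]
  rw [Finset.univ_sum_single fun i => S i x]
  exact hR x

theorem hasLeftInverse_col_tuple_of_right (h : (col T).HasLeftInverse) :
    (col (P.tuple S T)).HasLeftInverse := by
  obtain ⟨R, hR⟩ := h
  let B : Fin m → Y →L[ℂ] Y := fun j => R.comp (ContinuousLinearMap.single ℂ (fun _ => Y) j)
  refine ⟨∑ j, (P.map (ContinuousLinearMap.id ℂ X) (B j)).comp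
    (ContinuousLinearMap.proj (Fin.natAdd n j)), fun z => ?_⟩
  simp only [_root_.sum_apply, ContinuousLinearMap.comp_apply,
    ContinuousLinearMap.proj_apply, col_apply, tuple_natAdd, map_map_apply]
  refine P.sum_map_right _ z (ContinuousLinearMap.ext fun y => ?_)
  simp only [_root_.sum_apply, ContinuousLinearMap.comp_apply, B,
    ContinuousLinearMap.single_apply, ContinuousLinearMap.id_apply, ← map_sum]
  rw [Finset.univ_sum_single fun j => T j y]
  exact hR y

/-- Tensor products of rank one operators detect that the row operator of the tensor tuple is not
surjective. -/
theorem not_surjective_row_tuple (hS : ¬ Surjective (row S)) (hT : ¬ Surjective (row T)) :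
    ¬ Surjective (row (P.tuple S T)) := by
  intro hsurj
  obtain ⟨C, hC, hpre⟩ := (row (P.tuple S T)).exists_preimage_norm_le hsurj
  obtain ⟨M, hM, hMap⟩ := P.exists_norm_map_le
  -- The n + m terms of a preimage will contribute at most MεC each, while 1/16 bounds below the
  -- product of |u x|, ‖x‖, |v y| and ‖y‖, each at least 1/2.
  obtain ⟨ε, hε, hεlt⟩ : ∃ ε > 0, ε * ((n + m) * M * C) < 1 / 16 := by
    refine ⟨(1 / 16) / ((n + m) * M * C + 1), by positivity, ?_⟩
    rw [div_mul_eq_mul_div, div_lt_iff₀ (by positivity)]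
    linarith
  obtain ⟨u, hu, huS⟩ := (row S).exists_norm_eq_one_norm_comp_le hS hε
  obtain ⟨v, hv, hvT⟩ := (row T).exists_norm_eq_one_norm_comp_le hT hε
  obtain ⟨x, hx, hux⟩ := u.exists_lt_apply_of_lt_opNorm (r := 1 / 2) (by rw [hu]; norm_num)
  obtain ⟨y, hy, hvy⟩ := v.exists_lt_apply_of_lt_opNorm (r := 1 / 2) (by rw [hv]; norm_num)
  have hx' : 1 / 2 ≤ ‖x‖ := by simpa [hu] using hux.le.trans (u.le_opNorm x)
  have hy' : 1 / 2 ≤ ‖y‖ := by simpa [hv] using hvy.le.trans (v.le_opNorm y)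
  have huS' (i : Fin n) : ‖u.comp (S i)‖ ≤ ε := by
    refine ContinuousLinearMap.opNorm_le_bound _ hε.le fun w => ?_
    have := (u.comp (row S)).le_of_opNorm_le huS (Pi.single i w)
    simpa [row_single, Pi.norm_single] using this
  have hvT' (j : Fin m) : ‖v.comp (T j)‖ ≤ ε := by
    refine ContinuousLinearMap.opNorm_le_bound _ hε.le fun w => ?_
    have := (v.comp (row T)).le_of_opNorm_le hvT (Pi.single j w)
    simpa [row_single, Pi.norm_single] using this
  -- W(x ⊗ y) = u(x) v(y) x ⊗ y stays large, whereas W(Sᵢ ⊗ I) is the tensor product of the rank one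
  -- operators built from u ∘ Sᵢ and v, hence small; likewise W(I ⊗ Tⱼ).
  let W := P.map (u.smulRight x) (v.smulRight y)
  obtain ⟨a, ha, hanorm⟩ := hpre (P.tmul x y)
  have hz : ‖P.tmul x y‖ ≤ 1 := by
    rw [P.norm_tmul]
    exact mul_le_one₀ hx.le (norm_nonneg _) hy.le
  have haC (k : Fin (n + m)) : ‖a k‖ ≤ C :=
    (norm_le_pi_norm a k).trans (hanorm.trans (mul_le_of_le_one_right hC.le hz))
  have hlow : 1 / 16 ≤ ‖W (P.tmul x y)‖ := by
    simp only [W, P.map_tmul, P.norm_tmul, ContinuousLinearMap.smulRight_apply, norm_smul]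
    calc (1 / 16 : ℝ) = 1 / 2 * (1 / 2) * (1 / 2 * (1 / 2)) := by norm_num
      _ ≤ ‖u x‖ * ‖x‖ * (‖v y‖ * ‖y‖) := by gcongr
  have hleft (i : Fin n) (z : Z) (hz : ‖z‖ ≤ C) :
      ‖W (P.map (S i) (ContinuousLinearMap.id ℂ Y) z)‖ ≤ M * ε * C := by
    rw [map_map_apply]
    refine (ContinuousLinearMap.le_opNorm _ z).trans ?_
    refine mul_le_mul ((hMap _ _).trans ?_) hz (norm_nonneg _) (by positivity)
    rw [ContinuousLinearMap.comp_id,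
      show (u.smulRight x).comp (S i) = (u.comp (S i)).smulRight x from rfl,
      ContinuousLinearMap.norm_smulRight_apply, ContinuousLinearMap.norm_smulRight_apply, hv]
    calc M * (‖u.comp (S i)‖ * ‖x‖) * (1 * ‖y‖) ≤ M * (ε * 1) * (1 * 1) := by
          gcongr
          exact huS' i
      _ = M * ε := by ring
  have hright (j : Fin m) (z : Z) (hz : ‖z‖ ≤ C) :
      ‖W (P.map (ContinuousLinearMap.id ℂ X) (T j) z)‖ ≤ M * ε * C := by
    rw [map_map_apply]
    refine (ContinuousLinearMap.le_opNorm _ z).trans ?_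
    refine mul_le_mul ((hMap _ _).trans ?_) hz (norm_nonneg _) (by positivity)
    rw [ContinuousLinearMap.comp_id,
      show (v.smulRight y).comp (T j) = (v.comp (T j)).smulRight y from rfl,
      ContinuousLinearMap.norm_smulRight_apply, ContinuousLinearMap.norm_smulRight_apply, hu]
    calc M * (1 * ‖x‖) * (‖v.comp (T j)‖ * ‖y‖) ≤ M * (1 * 1) * (ε * 1) := by
          gcongr
          exact hvT' j
      _ = M * ε := by ring
  have hup : ‖W (P.tmul x y)‖ ≤ n * (M * ε * C) + m * (M * ε * C) := by
    rw [← ha, row_tuple_apply, map_add, map_sum, map_sum]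
    refine (norm_add_le _ _).trans (add_le_add ?_ ?_)
    · simpa using norm_sum_le_of_le Finset.univ fun i _ => hleft i _ (haC (Fin.castAdd m i))
    · simpa using norm_sum_le_of_le Finset.univ fun j _ => hright j _ (haC (Fin.natAdd n j))
  nlinarith

theorem prodSet_defectSpectrum_subset :
    prodSet (defectSpectrum S) (defectSpectrum T) ⊆ defectSpectrum (P.tuple S T) := by
  rintro _ ⟨l, hl, k, hk, rfl⟩
  simp only [defectSpectrum, Set.mem_ofPred_eq, Ne, rangeSum_eq_top_iff] at hl hk ⊢
  rw [shift_tuple]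
  exact P.not_surjective_row_tuple _ _ hl hk

/-- If x and y are unit approximate eigenvectors, x ⊗ y is one for the tensor tuple: the cross norm
property makes each error equal to the error in its own factor. -/
theorem prodSet_approxPointSpectrum_subset :
    prodSet (approxPointSpectrum S) (approxPointSpectrum T) ⊆
      approxPointSpectrum (P.tuple S T) := by
  rintro _ ⟨l, hl, k, hk, rfl⟩
  rw [mem_approxPointSpectrum] at hl hk ⊢
  intro ε hε
  obtain ⟨x, hx, hxS⟩ := hl ε hε
  obtain ⟨y, hy, hyT⟩ := hk ε hε
  refine ⟨P.tmul x y, by rw [P.norm_tmul, hx, hy, mul_one], fun i => ?_⟩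
  rw [shift_tuple]
  refine Fin.addCases (fun i => ?_) (fun j => ?_) i
  · rw [tuple_castAdd, P.map_tmul, P.norm_tmul, ContinuousLinearMap.id_apply, hy, mul_one]
    exact hxS i
  · rw [tuple_natAdd, P.map_tmul, P.norm_tmul, ContinuousLinearMap.id_apply, hx, one_mul]
    exact hyT j

theorem splitDefectSpectrum_subset :
    splitDefectSpectrum (P.tuple S T) ⊆
      prodSet (splitDefectSpectrum S) (splitDefectSpectrum T) := by
  refine subset_prodSet fun l k h => ?_
  rw [mem_splitDefectSpectrum, shift_tuple] at h
  exact ⟨mem_splitDefectSpectrum.2 (mt (P.hasRightInverse_row_tuple_of_left _ _) h),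
    mem_splitDefectSpectrum.2 (mt (P.hasRightInverse_row_tuple_of_right _ _) h)⟩

theorem splitApproxPointSpectrum_subset :
    splitApproxPointSpectrum (P.tuple S T) ⊆
      prodSet (splitApproxPointSpectrum S) (splitApproxPointSpectrum T) := by
  refine subset_prodSet fun l k h => ?_
  rw [mem_splitApproxPointSpectrum, shift_tuple] at h
  exact ⟨mem_splitApproxPointSpectrum.2 (mt (P.hasLeftInverse_col_tuple_of_left _ _) h),
    mem_splitApproxPointSpectrum.2 (mt (P.hasLeftInverse_col_tuple_of_right _ _) h)⟩

end BanachTensorProduct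

open OperatorTuple in
theorem proposition4p1 {X₁ X₂ Z : Type*}
    [NormedAddCommGroup X₁] [NormedSpace ℂ X₁] [CompleteSpace X₁]
    [NormedAddCommGroup X₂] [NormedSpace ℂ X₂] [CompleteSpace X₂]
    [NormedAddCommGroup Z] [NormedSpace ℂ Z] [CompleteSpace Z]
    (P : BanachTensorProduct X₁ X₂ Z) (n m : ℕ)
    (S : Fin n → X₁ →L[ℂ] X₁) (hS : ∀ i j, Commute (S i) (S j))
    (T : Fin m → X₂ →L[ℂ] X₂) (hT : ∀ i j, Commute (T i) (T j)) :
    (prodSet (defectSpectrum S) (defectSpectrum T) ⊆ defectSpectrum (P.tuple S T) ∧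
      defectSpectrum (P.tuple S T) ⊆ splitDefectSpectrum (P.tuple S T) ∧
      splitDefectSpectrum (P.tuple S T) ⊆
        prodSet (splitDefectSpectrum S) (splitDefectSpectrum T)) ∧
    (prodSet (approxPointSpectrum S) (approxPointSpectrum T) ⊆
        approxPointSpectrum (P.tuple S T) ∧
      approxPointSpectrum (P.tuple S T) ⊆ splitApproxPointSpectrum (P.tuple S T) ∧
      splitApproxPointSpectrum (P.tuple S T) ⊆
        prodSet (splitApproxPointSpectrum S) (splitApproxPointSpectrum T)) ∧
    (IsHilbertSpace X₁ → IsHilbertSpace X₂ →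
      (prodSet (defectSpectrum S) (defectSpectrum T) = defectSpectrum (P.tuple S T) ∧
        defectSpectrum (P.tuple S T) = splitDefectSpectrum (P.tuple S T) ∧
        splitDefectSpectrum (P.tuple S T) =
          prodSet (splitDefectSpectrum S) (splitDefectSpectrum T)) ∧
      (prodSet (approxPointSpectrum S) (approxPointSpectrum T) =
          approxPointSpectrum (P.tuple S T) ∧
        approxPointSpectrum (P.tuple S T) = splitApproxPointSpectrum (P.tuple S T) ∧
        splitApproxPointSpectrum (P.tuple S T) =
          prodSet (splitApproxPointSpectrum S) (splitApproxPointSpectrum T))) := by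
  have hd := P.prodSet_defectSpectrum_subset S T
  have hd' := P.splitDefectSpectrum_subset S T
  have ha := P.prodSet_approxPointSpectrum_subset S T
  have ha' := P.splitApproxPointSpectrum_subset S T
  have hds : defectSpectrum (P.tuple S T) ⊆ splitDefectSpectrum (P.tuple S T) :=
    Set.subset_union_left
  have has : approxPointSpectrum (P.tuple S T) ⊆ splitApproxPointSpectrum (P.tuple S T) :=
    Set.subset_union_left
  refine ⟨⟨hd, hds, hd'⟩, ⟨ha, has, ha'⟩, fun h₁ h₂ => ?_⟩
  -- Only the factors are assumed Hilbert; the spectra on the tensor product are squeezed between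
  -- outer products that now coincide.
  rw [splitDefectSpectrum_eq_of_isHilbertSpace h₁, splitDefectSpectrum_eq_of_isHilbertSpace h₂]
    at hd' ⊢
  rw [splitApproxPointSpectrum_eq_of_isHilbertSpace h₁,
    splitApproxPointSpectrum_eq_of_isHilbertSpace h₂] at ha' ⊢
  exact ⟨⟨hd.antisymm (hds.trans hd'), hds.antisymm (hd'.trans hd), hd'.antisymm (hd.trans hds)⟩,
    ha.antisymm (has.trans ha'), has.antisymm (ha'.trans ha), ha'.antisymm (ha.trans has)⟩
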